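/- **Theorem 2.1 (The Copula Case).** Let $d\ge 1$. Let $\mathbf X=(X_1,\dots,X_d)$ be a random vector whose distribution function is a copula $C$ on $\mathbb R^d$ (i.e. every component $X_i$ is uniformly distributed on $[0,1]$), and let $\mathbf X^{(1)},\mathbf X^{(2)},\dots$ be independent copies of $\mathbf X$. For $1\le j\le n$ and $1\le i\le d$ let $X_{j:n,i}$ denote the $j$-th smallest among the $i$-th components of $\mathbf X^{(1)},\dots,\mathbf X^{(n)}$, so that $X_{1:n,i}\le\dots\le X_{n:n,i}$. A norm $\|\cdot\|_D$ on $\mathbb R^d$ is called a $D$-norm if there is a random vector $\mathbf Z=(Z_1,\dots,Z_d)$ with $Z_i\ge 0$ and $E(Z_i)=1$ for $1\le i\le d$ such that $\|\mathbf x\|_D=E\left(\max_{1\le i\le d}|x_i|Z_i\right)$ for all $\mathbf x\in\mathbb R^d$. Suppose that for some $D$-norm $\|\cdot\|_D$ $$C(\mathbf u)=1-\|\mathbf 1-\mathbf u\|_D+o(\|\mathbf 1-\mathbf u\|)\qquad\text{as }\mathbf u\to\mathbf 1=(1,\dots,1),\text{ uniformly for }\mathbf u\in[0,1]^d.$$ For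 $n\ge 2$ let $\mathbf k=\mathbf k(n)=(k_1,\dots,k_d)\in\{1,\dots,n-1\}^d$ be such that, as $n\to\infty$, $\|\mathbf k\|\to\infty$, $\|\mathbf k\|/n\to 0$, and $k_i/k_j\to k_{ij}^2\in(0,\infty)$ with $k_{ij}>0$ for all $1\le i,j\le d$. (Given the last condition, the first two say that $k_i\to\infty$ and $k_i/n\to0$ for every $i$.) Let $\mathbf e_i$ denote the $i$-th unit vector of $\mathbb R^d$ and let $\Sigma=(\sigma_{ij})$ be the $d\times d$ matrix with $$\sigma_{ij}=\begin{cases}1, & i=j,\\ k_{ij}+k_{ji}-\|k_{ij}\mathbf e_i+k_{ji}\mathbf e_j\|_D, & i\ne j.\end{cases}$$ Then $\Sigma$ is positive semidefinite (so that it is a covariance matrix), and $$\left(\frac{n}{\sqrt{k_i}}\left(X_{n-k_i:n,i}-\frac{n-k_i}{n}\right)\right)_{i=1}^d\ \to_D\ N(\mathbf 0,\Sigma)\qquad(n\to\infty).$$ -/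

import Mathlib

open MeasureTheory ProbabilityTheory Filter Asymptotics
open scoped Topology

noncomputable section

/-- `C` is a copula on `ℝ ^ d`: the distribution function of a probability measure on `ℝ ^ d` all
of whose one-dimensional margins are the uniform distribution on `[0, 1]`. The order on
`Fin d → ℝ` is componentwise, so `Set.Iic x` is the lower orthant `(-∞, x]`. -/
def IsCopula {d : ℕ} (C : (Fin d → ℝ) → ℝ) : Prop :=
  ∃ P : Measure (Fin d → ℝ), IsProbabilityMeasure P ∧
    (∀ i, P.map (fun x => x i) = volume.restrict (Set.Icc (0 : ℝ) 1)) ∧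
    ∀ x, C x = P.real (Set.Iic x)

/-- `N` is a D-norm on `ℝ ^ d`: there is a generator `Z = (Z_1, …, Z_d)` (represented by its law
`ν` on `ℝ ^ d`) with `Z_i ≥ 0`, `E Z_i = 1` and `N x = E (max_i |x_i| Z_i)` for all `x`.
Every such `N` is a norm, as follows from the three properties. -/
def IsDNorm {d : ℕ} (N : (Fin d → ℝ) → ℝ) : Prop :=
  ∃ ν : Measure (Fin d → ℝ), IsProbabilityMeasure ν ∧
    (∀ i, ∀ᵐ z ∂ν, 0 ≤ z i) ∧
    (∀ i, Integrable (fun z => z i) ν ∧ ∫ z, z i ∂ν = 1) ∧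
    ∀ x, N x = ∫ z, (⨆ i, |x i| * z i) ∂ν

/-- The expansion `C u = 1 - N (1 - u) + o(‖1 - u‖)` as `u → (1, …, 1)`, uniformly for `u` in the
cube `[0, 1] ^ d`. -/
def HasDNormExpansion {d : ℕ} (C N : (Fin d → ℝ) → ℝ) : Prop :=
  (fun u : Fin d → ℝ => C u - (1 - N (1 - u)))
    =o[𝓝[Set.Icc (0 : Fin d → ℝ) 1] 1] (fun u : Fin d → ℝ => ‖1 - u‖)

/-- The `j`-th order statistic `x_{j:n}` (`1 ≤ j ≤ n`, counted from the smallest) of the real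
numbers `x 0, …, x (n - 1)`: the `j`-th entry after sorting increasingly. It is set to `0` when
`j` is not in `{1, …, n}`. -/
def orderStat {n : ℕ} (x : Fin n → ℝ) (j : ℕ) : ℝ :=
  if h : 1 ≤ j ∧ j ≤ n then x (Tuple.sort x ⟨j - 1, by omega⟩) else 0

/-- The vector with components `(n / √k_i) * (X_{n - k_i : n, i} - (n - k_i) / n)`, where
`X_{1:n,i} ≤ … ≤ X_{n:n,i}` are the ordered `i`-th components of the first `n` vectors of the
sequence `X`. -/
def normalizedIntermediateOS {Ω : Type*} {d : ℕ} (X : ℕ → Ω → Fin d → ℝ) (k : ℕ → Fin d → ℕ)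
    (n : ℕ) (ω : Ω) : EuclideanSpace ℝ (Fin d) :=
  WithLp.toLp 2 fun i =>
    (n : ℝ) / √(k n i : ℝ) *
      (orderStat (fun m : Fin n => X m ω i) (n - k n i) - ((n : ℝ) - (k n i : ℝ)) / (n : ℝ))

/-- The matrix with `σ_ii = 1` and `σ_ij = κ_ij + κ_ji - N (κ_ij e_i + κ_ji e_j)` for `i ≠ j`. -/
def intermediateCov {d : ℕ} (N : (Fin d → ℝ) → ℝ) (κ : Fin d → Fin d → ℝ) :
    Matrix (Fin d) (Fin d) ℝ :=
  Matrix.of fun i j =>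
    if i = j then 1
    else κ i j + κ j i - N (κ i j • Pi.single i (1 : ℝ) + κ j i • Pi.single j (1 : ℝ))

end

/-! An upper order statistic is inverted into a count: `X_{n-k:n} ≤ a` holds exactly when at least
`n - k` observations are `≤ a`. With `a = 1 - k/n + y√k/n`, the event "normalized order statistic `≤
y`" becomes "centred count at level `a`, divided by `√k`, is `≤ y`"
(`normalizedIntermediateOS_apply_le_iff`). The level still depends on `y`, but moving it back to `1
- k/n` changes the normalized count by a variable of second moment at most `|y|/√k`, which tends to
`0`. A grid argument (`tendstoInMeasure_sub_of_le_iff`) turns this, for all fixed `y`, into: order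
statistic minus count at level `1 - k/n` tends to `0` in probability.

The counts are sums of i.i.d. bounded centred vectors, uniformly of order `1/√k_i` in coordinate
`i`, so a central limit theorem for the triangular array follows from characteristic functions once
the covariances converge. These are governed by the copula near the corner: with `p = k_i/n`, `q =
k_j/n`, the covariance of the two indicators is `C(u) - (1-p)(1-q) = p + q - N(p e_i + q e_j) - pq +
o(p+q)`. After multiplication by `n/√(k_i k_j)`, homogeneity and continuity of `N` give `σ_ij`
(`tendsto_covariance`). Positive semidefiniteness comes for free, as the quadratic form is a limit
of second moments. -/

/-- The centred indicator `a - 1_{s ≤ a}`; its mean is `0` when `s` is uniform on `[0, 1]` and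
`a ∈ [0, 1]`. -/
noncomputable def centeredBelow (a s : ℝ) : ℝ := a - (Set.Iic a).indicator 1 s

lemma measurable_centeredBelow (a : ℝ) : Measurable (centeredBelow a) :=
  measurable_const.sub (measurable_one.indicator measurableSet_Iic)

lemma abs_centeredBelow_le {a : ℝ} (h0 : 0 ≤ a) (h1 : a ≤ 1) (s : ℝ) :
    |centeredBelow a s| ≤ 1 := by
  unfold centeredBelow
  by_cases h : s ∈ Set.Iic a <;> simp only [h, Set.indicator_of_mem, Set.indicator_of_notMem,
    not_false_eq_true, Pi.one_apply] <;> rw [abs_le] <;> constructor <;> linarith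

/-! ### Order statistics as counts -/

section OrderStat

/-- Sorting permutes the summands of the count, and in the sorted vector the entries `≤ a` form an
initial segment. -/
lemma orderStat_le_iff {n : ℕ} (x : Fin n → ℝ) {j : ℕ} (h1 : 1 ≤ j) (hn : j ≤ n) (a : ℝ) :
    orderStat x j ≤ a ↔ (j : ℝ) ≤ ∑ m, (Set.Iic a).indicator (1 : ℝ → ℝ) (x m) := by
  have hcard : ∑ m, (Set.Iic a).indicator (1 : ℝ → ℝ) (x m)
      = ((Finset.univ.filter fun m => x (Tuple.sort x m) ≤ a).card : ℝ) := by
    rw [← Equiv.sum_comp (Tuple.sort x), Finset.card_filter]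
    push_cast
    refine Finset.sum_congr rfl fun m _ => ?_
    simp [Set.indicator_apply]
  rw [hcard, Nat.cast_le, orderStat, dif_pos ⟨h1, hn⟩]
  have := Tuple.lt_card_le_iff_apply_le_of_monotone (a := a) (j := ⟨j - 1, by omega⟩)
    (Tuple.monotone_sort x)
  simp only [Function.comp_apply] at this
  rw [← this]
  -- The sorted vector is indexed from `0`, so `j - 1 < card` has to become `j ≤ card`, which uses
  -- `1 ≤ j`.
  change _ ↔ j ≤ _
  constructor <;> intro h <;> omega

lemma measurable_orderStat {n : ℕ} (j : ℕ) : Measurable fun x : Fin n → ℝ => orderStat x j := by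
  by_cases h : 1 ≤ j ∧ j ≤ n
  · refine measurable_of_Iic fun a => ?_
    have : (fun x : Fin n → ℝ => orderStat x j) ⁻¹' Set.Iic a
        = {x | (j : ℝ) ≤ ∑ m, (Set.Iic a).indicator (1 : ℝ → ℝ) (x m)} := by
      ext x
      simpa using orderStat_le_iff x h.1 h.2 a
    rw [this]
    refine measurableSet_le measurable_const (Finset.measurable_sum _ fun m _ => ?_)
    exact (measurable_one.indicator measurableSet_Iic).comp (measurable_pi_apply m)
  · simp only [orderStat, dif_neg h]
    exact measurable_const

/-- An upper order statistic is at most `a` iff the centred count of points below `a` is small. -/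
lemma orderStat_sub_le_iff {n k : ℕ} (hk : k + 1 ≤ n) (x : Fin n → ℝ) (a : ℝ) :
    orderStat x (n - k) ≤ a ↔ ∑ m, centeredBelow a (x m) ≤ n * a - (n - k) := by
  rw [orderStat_le_iff x (by omega) (by omega), Nat.cast_sub (by omega)]
  simp only [centeredBelow, Finset.sum_sub_distrib, Finset.sum_const, Finset.card_univ,
    Fintype.card_fin, nsmul_eq_mul]
  constructor <;> intro h <;> linarith

end OrderStat

/-! ### Probabilistic limit tools -/

section Limits

variable {Ω : Type*} [MeasurableSpace Ω] {μ : Measure Ω} [IsProbabilityMeasure μ]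

/-- A criterion of Ghosh type: if `W` is tight, `{V n ≤ y} = {T y n ≤ y}` eventually and
`T y n - W n → 0` in probability for every `y`, then `V n - W n → 0` in probability. -/
lemma tendstoInMeasure_sub_of_le_iff {V W : ℕ → Ω → ℝ} {T : ℝ → ℕ → Ω → ℝ}
    (hW : ∀ δ > 0, ∃ M : ℝ, ∀ᶠ n in atTop, μ.real {ω | M ≤ |W n ω|} ≤ δ)
    (hV : ∀ y, ∀ᶠ n in atTop, ∀ ω, V n ω ≤ y ↔ T y n ω ≤ y)
    (hT : ∀ y, ∀ ε > 0,
      Tendsto (fun n => μ.real {ω | ε ≤ |T y n ω - W n ω|}) atTop (𝓝 0)) :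
    ∀ ε > 0, Tendsto (fun n => μ.real {ω | ε ≤ |V n ω - W n ω|}) atTop (𝓝 0) := by
  intro ε' hε'
  obtain ⟨ε, hε, rfl⟩ : ∃ ε > 0, ε' = 3 * ε := ⟨ε' / 3, by positivity, by ring⟩
  rw [Metric.tendsto_nhds]
  intro δ hδ
  obtain ⟨M, hM⟩ := hW (δ / 2) (by positivity)
  -- When `|W| < M`, the grid points of `εℤ` used below lie at most one step beyond `±⌈M/ε⌉`; hence
  -- finitely many levels `y` suffice.
  set L : ℤ := ⌈M / ε⌉ + 2 with hL
  set G : Finset ℤ := Finset.Icc (-L) L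
  have hsum : Tendsto (fun n => ∑ l ∈ G, μ.real {ω | ε ≤ |T (l * ε) n ω - W n ω|}) atTop (𝓝 0) := by
    simpa using tendsto_finsetSum G fun (l : ℤ) _ => hT (l * ε) ε hε
  have hVG : ∀ᶠ n in atTop, ∀ l ∈ G, ∀ ω, V n ω ≤ l * ε ↔ T (l * ε) n ω ≤ l * ε :=
    (Filter.eventually_all_finset G).2 fun l _ => hV _
  filter_upwards [hM, hVG, hsum.eventually_lt_const (by positivity : (0 : ℝ) < δ / 2)]
    with n hMn hVn hsn
  have hsub : {ω | 3 * ε ≤ |V n ω - W n ω|} ⊆ {ω | M ≤ |W n ω|} ∪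
      ⋃ l ∈ G, {ω | ε ≤ |T (l * ε) n ω - W n ω|} := by
    intro ω hω
    by_cases hωM : M ≤ |W n ω|
    · exact Or.inl hωM
    refine Or.inr ?_
    simp only [Set.mem_iUnion, Set.mem_ofPred_eq, exists_prop] at hω ⊢
    have hlt := abs_lt.1 (not_le.1 hωM)
    have hMc := Int.le_ceil (M / ε)
    have h1 : W n ω / ε < M / ε := by gcongr; exact hlt.2
    have h2 : -(M / ε) < W n ω / ε := by rw [← neg_div]; gcongr; exact hlt.1
    rcases le_abs.1 hω with h | h
    · have hc1 := Int.le_ceil (W n ω / ε)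
      have hc2 := Int.ceil_lt_add_one (W n ω / ε)
      have hlG : ⌈W n ω / ε⌉ + 1 ∈ G := by
        rw [Finset.mem_Icc]
        constructor
        · have : -(⌈M / ε⌉ : ℝ) < ⌈W n ω / ε⌉ := by linarith
          have : -⌈M / ε⌉ < ⌈W n ω / ε⌉ := by exact_mod_cast this
          omega
        · have : ⌈W n ω / ε⌉ ≤ ⌈M / ε⌉ := Int.ceil_mono h1.le
          omega
      refine ⟨_, hlG, ?_⟩
      have hiff := hVn _ hlG ω
      push_cast at hiff ⊢
      have e : W n ω / ε * ε = W n ω := by field_simp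
      have b1 : W n ω ≤ ⌈W n ω / ε⌉ * ε := by rw [← div_le_iff₀ hε]; exact hc1
      have b2 : ⌈W n ω / ε⌉ * ε < W n ω + ε := by
        have := mul_lt_mul_of_pos_right hc2 hε
        linarith [add_mul (W n ω / ε) 1 ε]
      have : ¬ T ((⌈W n ω / ε⌉ + 1) * ε) n ω ≤ (⌈W n ω / ε⌉ + 1) * ε := by
        rw [← hiff]; intro h'; linarith
      rw [not_le] at this
      exact le_abs.2 (Or.inl (by linarith))
    · have hc1 := Int.floor_le (W n ω / ε)
      have hc2 := Int.lt_floor_add_one (W n ω / ε)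
      have hlG : ⌊W n ω / ε⌋ - 1 ∈ G := by
        rw [Finset.mem_Icc]
        constructor
        · have : -(⌈M / ε⌉ : ℝ) < ⌊W n ω / ε⌋ + 1 := by linarith
          have : -⌈M / ε⌉ < ⌊W n ω / ε⌋ + 1 := by exact_mod_cast this
          omega
        · have : (⌊W n ω / ε⌋ : ℝ) ≤ ⌈M / ε⌉ := by linarith
          have : ⌊W n ω / ε⌋ ≤ ⌈M / ε⌉ := by exact_mod_cast this
          omega
      refine ⟨_, hlG, ?_⟩
      have hiff := hVn _ hlG ω
      push_cast at hiff ⊢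
      have e : W n ω / ε * ε = W n ω := by field_simp
      have b1 : ⌊W n ω / ε⌋ * ε ≤ W n ω := by rw [← le_div_iff₀ hε]; exact hc1
      have b2 : W n ω - ε < ⌊W n ω / ε⌋ * ε := by
        have := mul_lt_mul_of_pos_right hc2 hε
        linarith [add_mul (⌊W n ω / ε⌋ : ℝ) 1 ε]
      have : T ((⌊W n ω / ε⌋ - 1) * ε) n ω ≤ (⌊W n ω / ε⌋ - 1) * ε := by
        rw [← hiff]; linarith
      exact le_abs.2 (Or.inr (by linarith))
  rw [Real.dist_eq, sub_zero, abs_of_nonneg measureReal_nonneg]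
  calc μ.real {ω | 3 * ε ≤ |V n ω - W n ω|}
      ≤ μ.real ({ω | M ≤ |W n ω|} ∪ ⋃ l ∈ G, {ω | ε ≤ |T (l * ε) n ω - W n ω|}) :=
        measureReal_mono hsub
    _ ≤ μ.real {ω | M ≤ |W n ω|} + μ.real (⋃ l ∈ G, {ω | ε ≤ |T (l * ε) n ω - W n ω|}) :=
        measureReal_union_le _ _
    _ ≤ δ / 2 + ∑ l ∈ G, μ.real {ω | ε ≤ |T (l * ε) n ω - W n ω|} :=
        add_le_add hMn (measureReal_biUnion_finset_le _ _)
    _ < δ := by linarith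

/-- Chebyshev's inequality for a sum of independent, identically distributed, bounded, centred
random variables. -/
lemma measureReal_le_abs_sum_le {E : Type*} [MeasurableSpace E] {X : ℕ → Ω → E} {P : Measure E}
    [IsProbabilityMeasure P]
    (hX : ∀ m, Measurable (X m)) (hind : iIndepFun X μ) (hlaw : ∀ m, μ.map (X m) = P)
    {f : E → ℝ} (hf : Measurable f) {B : ℝ} (hB : ∀ x, |f x| ≤ B) (hf0 : ∫ x, f x ∂P = 0)
    (n : ℕ) {c : ℝ} (hc : 0 < c) :
    μ.real {ω | c ≤ |∑ m : Fin n, f (X m ω)|} ≤ n * (∫ x, f x ^ 2 ∂P) / c ^ 2 := by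
  have hLp : ∀ m, MemLp (fun ω => f (X m ω)) 2 μ := fun m =>
    MemLp.of_bound (hf.comp (hX m)).aestronglyMeasurable B (.of_forall fun ω => hB _)
  have h0 : ∀ m, ∫ ω, f (X m ω) ∂μ = 0 := fun m => by
    rw [← hf0, ← hlaw m, integral_map (hX m).aemeasurable hf.aestronglyMeasurable]
  have hvar : ∀ m, Var[fun ω => f (X m ω); μ] = ∫ x, f x ^ 2 ∂P := fun m => by
    rw [variance_of_integral_eq_zero (X := fun ω => f (X m ω))
      (hf.comp (hX m)).aemeasurable (h0 m), ← hlaw m,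
      integral_map (hX m).aemeasurable (hf.pow_const 2).aestronglyMeasurable]
  have hsumLp : MemLp (∑ m : Fin n, fun ω => f (X m ω)) 2 μ :=
    memLp_finsetSum' _ fun m _ => hLp m
  have hV : Var[∑ m : Fin n, fun ω => f (X m ω); μ] = n * ∫ x, f x ^ 2 ∂P := by
    rw [IndepFun.variance_sum (X := fun (m : Fin n) ω => f (X m ω)) (fun m _ => hLp m)]
    · simp [hvar]
    · intro i _ j _ hij
      exact (hind.indepFun (by simpa [Fin.val_inj] using hij)).comp hf hf
  have h := meas_ge_le_variance_div_sq hsumLp hc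
  have hmean : ∫ ω, (∑ m : Fin n, fun ω => f (X m ω)) ω ∂μ = 0 := by
    simp only [Finset.sum_apply]
    rw [integral_finsetSum (f := fun (m : Fin n) ω => f (X m ω)) _
      fun m _ => (hLp m).integrable one_le_two]
    simp [h0]
  rw [hmean, hV] at h
  have hnn : 0 ≤ n * (∫ x, f x ^ 2 ∂P) / c ^ 2 := by
    have : 0 ≤ ∫ x, f x ^ 2 ∂P := integral_nonneg fun x => sq_nonneg _
    positivity
  simpa [Measure.real] using ENNReal.toReal_le_of_le_ofReal hnn h

lemma norm_exp_ofReal_mul_I_sub_le {y : ℝ} (hy : |y| ≤ 1) :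
    ‖Complex.exp (y * Complex.I) - (1 + y * Complex.I - y ^ 2 / 2)‖ ≤ |y| ^ 3 := by
  have h := Complex.exp_bound (x := y * Complex.I) (by simpa using hy) (n := 3) (by norm_num)
  have e : ∑ m ∈ Finset.range 3, ((y : ℂ) * Complex.I) ^ m / m.factorial
      = 1 + y * Complex.I - y ^ 2 / 2 := by
    simp [Finset.sum_range_succ, mul_pow]
    ring
  rw [e] at h
  refine h.trans ?_
  simp only [norm_mul, Complex.norm_real, Complex.norm_I, mul_one, Real.norm_eq_abs]
  have : (0 : ℝ) ≤ |y| ^ 3 := by positivity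
  norm_num [Nat.factorial]
  linarith

/-- The analytic core of the central limit theorem for triangular arrays with uniformly small
summands, in terms of characteristic functions. -/
lemma tendsto_integral_exp_pow {E : Type*} [MeasurableSpace E] {P : Measure E}
    [IsProbabilityMeasure P] {Y : ℕ → E → ℝ} {b : ℕ → ℝ} {s : ℝ}
    (hY : ∀ n, Measurable (Y n)) (hb : Tendsto b atTop (𝓝 0))
    (hYb : ∀ᶠ n in atTop, ∀ x, |Y n x| ≤ b n)
    (h0 : ∀ᶠ n in atTop, ∫ x, Y n x ∂P = 0)
    (hs : Tendsto (fun n : ℕ => n * ∫ x, Y n x ^ 2 ∂P) atTop (𝓝 s)) :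
    Tendsto (fun n => (∫ x, Complex.exp (Y n x * Complex.I) ∂P) ^ n) atTop
      (𝓝 (Complex.exp (-(s : ℂ) / 2))) := by
  -- A second-order expansion of the exponential leaves a cubic error `|Y|³ ≤ b Y²`, so after
  -- multiplication by `n` the total error is at most `b n * (n ∫ Y²) → 0`.
  have key : Tendsto (fun n : ℕ => (n : ℂ) * ((∫ x, Complex.exp (Y n x * Complex.I) ∂P) - 1)) atTop
      (𝓝 (-(s : ℂ) / 2)) := by
    have hs' : Tendsto (fun n : ℕ => ((-(n * ∫ x, Y n x ^ 2 ∂P) / 2 : ℝ) : ℂ)) atTop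
        (𝓝 (-(s : ℂ) / 2)) := by
      have := (Complex.continuous_ofReal.tendsto _).comp (hs.neg.div_const 2)
      simpa [Function.comp_def] using this
    have hz : Tendsto (fun n : ℕ => b n * (n * ∫ x, Y n x ^ 2 ∂P)) atTop (𝓝 0) := by
      simpa using hb.mul hs
    refine (hs'.congr_dist ?_)
    refine squeeze_zero' (.of_forall fun _ => dist_nonneg) ?_ hz
    filter_upwards [hYb, h0, hb.eventually_le_const zero_lt_one] with n hn h0n hb1
    have hle : ∀ x, |Y n x| ≤ 1 := fun x => (hn x).trans hb1
    have hint : Integrable (Y n) P :=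
      Integrable.of_bound (hY n).aestronglyMeasurable 1 (.of_forall hle)
    have hint2 : Integrable (fun x => Y n x ^ 2) P :=
      Integrable.of_bound ((hY n).pow_const 2).aestronglyMeasurable 1 (.of_forall fun x => by
        rw [Real.norm_eq_abs, abs_pow]; exact pow_le_one₀ (abs_nonneg _) (hle x))
    have hexp : Integrable (fun x => Complex.exp (Y n x * Complex.I)) P :=
      Integrable.of_bound (by
        have := hY n
        exact (by fun_prop : Measurable fun x => Complex.exp (Y n x * Complex.I)).aestronglyMeasurable)
        1 (.of_forall fun x => by rw [Complex.norm_exp_ofReal_mul_I])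
    have hint2c : Integrable (fun x => (Y n x : ℂ) ^ 2) P := by
      exact_mod_cast hint2.ofReal (𝕜 := ℂ)
    have hmul : Integrable (fun x => Y n x * Complex.I) P := hint.ofReal.mul_const _
    have hlin : Integrable (fun x => (1 : ℂ) + Y n x * Complex.I) P := (integrable_const _).add hmul
    have hpoly : ∫ x, ((1 : ℂ) + Y n x * Complex.I - Y n x ^ 2 / 2) ∂P
        = 1 - ((∫ x, Y n x ^ 2 ∂P : ℝ) : ℂ) / 2 := by
      rw [integral_sub hlin (hint2c.div_const _),
        integral_add (integrable_const _) hmul, integral_mul_const,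
        integral_div, integral_complex_ofReal, h0n, ← integral_complex_ofReal]
      simp
    have hpolyint : Integrable (fun x => (1 : ℂ) + Y n x * Complex.I - Y n x ^ 2 / 2) P :=
      hlin.sub (hint2c.div_const _)
    rw [dist_comm, dist_eq_norm]
    have heq : (n : ℂ) * ((∫ x, Complex.exp (Y n x * Complex.I) ∂P) - 1)
        - ((-(n * ∫ x, Y n x ^ 2 ∂P) / 2 : ℝ) : ℂ)
        = n * ∫ x, (Complex.exp (Y n x * Complex.I)
            - ((1 : ℂ) + Y n x * Complex.I - Y n x ^ 2 / 2)) ∂P := by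
      rw [integral_sub hexp hpolyint, hpoly]
      push_cast
      ring
    rw [heq, norm_mul, Complex.norm_natCast]
    have hbd : ‖∫ x, (Complex.exp (Y n x * Complex.I)
            - ((1 : ℂ) + Y n x * Complex.I - Y n x ^ 2 / 2)) ∂P‖ ≤ ∫ x, b n * Y n x ^ 2 ∂P := by
      refine norm_integral_le_of_norm_le (hint2.const_mul _) (.of_forall fun x => ?_)
      refine (norm_exp_ofReal_mul_I_sub_le (hle x)).trans ?_
      rw [pow_succ', sq_abs]
      exact mul_le_mul_of_nonneg_right (hn x) (sq_nonneg _)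
    rw [integral_const_mul] at hbd
    calc _ ≤ (n : ℝ) * (b n * ∫ x, Y n x ^ 2 ∂P) := by gcongr
      _ = _ := by ring
  simpa using Complex.tendsto_one_add_pow_exp_of_tendsto key

end Limits

/-! ### Distribution functions and D-norms -/

/-- A finite measure on `ℝ ^ ι` is determined by its distribution function. -/
lemma Measure.ext_of_Iic_pi {ι : Type*} [Finite ι] {P Q : Measure (ι → ℝ)}
    [IsProbabilityMeasure P] [IsProbabilityMeasure Q]
    (h : ∀ x, P (Set.Iic x) = Q (Set.Iic x)) : P = Q := by
  classical
  have := Fintype.ofFinite ι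
  refine ext_of_generate_finite (Set.range Set.Iic) ?_ ?_ ?_ (by simp)
  · refine le_antisymm ?_ (MeasurableSpace.generateFrom_le ?_)
    · refine iSup_le fun i => ?_
      rw [borel_eq_generateFrom_Iic ℝ |> fun e => (BorelSpace.measurable_eq (α := ℝ)).trans e,
        MeasurableSpace.comap_generateFrom]
      refine MeasurableSpace.generateFrom_le ?_
      rintro _ ⟨_, ⟨a, rfl⟩, rfl⟩
      -- A half-space is the countable union of the orthants whose remaining coordinates are bounded
      -- by `n`.
      have : (fun x : ι → ℝ => x i) ⁻¹' Set.Iic a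
          = ⋃ n : ℕ, Set.Iic (Function.update (fun _ => (n : ℝ)) i a) := by
        ext x
        simp only [Set.mem_preimage, Set.mem_Iic, Set.mem_iUnion]
        constructor
        · intro hx
          obtain ⟨n, hn⟩ := exists_nat_ge (∑ j, |x j|)
          refine ⟨n, fun j => ?_⟩
          by_cases hj : j = i
          · subst hj; simpa using hx
          · simp only [Function.update_of_ne hj]
            exact (le_abs_self _).trans ((Finset.single_le_sum (f := fun j => |x j|)
              (fun _ _ => abs_nonneg _) (Finset.mem_univ j)).trans hn)
        · rintro ⟨n, hn⟩
          simpa using hn i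
      rw [this]
      exact MeasurableSet.iUnion fun n => MeasurableSpace.measurableSet_generateFrom ⟨_, rfl⟩
    · rintro _ ⟨x, rfl⟩
      exact measurableSet_Iic
  · rintro _ ⟨x, rfl⟩ _ ⟨y, rfl⟩ -
    exact ⟨x ⊓ y, Set.Iic_inter_Iic.symm⟩
  · rintro _ ⟨x, rfl⟩
    exact h x

lemma abs_ciSup_sub_ciSup_le {ι : Type*} [Fintype ι] (a b : ι → ℝ) :
    |(⨆ i, a i) - ⨆ i, b i| ≤ ∑ i, |a i - b i| := by
  rcases isEmpty_or_nonempty ι with h | h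
  · simp
  have key : ∀ a b : ι → ℝ, (⨆ i, a i) ≤ (⨆ i, b i) + ∑ i, |a i - b i| := fun a b =>
    ciSup_le fun i => by
      have h1 := le_ciSup (Set.finite_range b).bddAbove i
      have h2 := Finset.single_le_sum (f := fun i => |a i - b i|) (fun _ _ => abs_nonneg _)
        (Finset.mem_univ i)
      have h3 := le_abs_self (a i - b i)
      linarith
  have h1 := key a b
  have h2 := key b a
  simp only [abs_sub_comm (b _) (a _)] at h2
  exact abs_sub_le_iff.2 ⟨by linarith, by linarith⟩

namespace IsDNorm

variable {d : ℕ} {N : (Fin d → ℝ) → ℝ}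

/-- A maximum moves by at most the sum of the changes of its entries, and `E Z_i = 1` turns these
into `|x_i - y_i|`. -/
lemma abs_sub_le (hN : IsDNorm N) (x y : Fin d → ℝ) : |N x - N y| ≤ ∑ i, |x i - y i| := by
  obtain ⟨ν, _, hpos, hint, hNx⟩ := hN
  have hsum : ∀ c : Fin d → ℝ, Integrable (fun z : Fin d → ℝ => ∑ i, |c i * z i|) ν := fun c =>
    integrable_finsetSum _ fun i _ => ((hint i).1.const_mul _).abs
  have hsup : ∀ x : Fin d → ℝ, Integrable (fun z : Fin d → ℝ => ⨆ i, |x i| * z i) ν := fun x => by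
    refine (hsum x).mono' (Measurable.iSup fun i =>
      (measurable_pi_apply i).const_mul _).aestronglyMeasurable (.of_forall fun z => ?_)
    have := abs_ciSup_sub_ciSup_le (fun i => |x i| * z i) fun _ => 0
    simpa [abs_mul] using this
  rw [hNx, hNx, ← integral_sub (hsup x) (hsup y)]
  calc |∫ z, ((⨆ i, |x i| * z i) - ⨆ i, |y i| * z i) ∂ν|
      ≤ ∫ z, ∑ i, |x i - y i| * z i ∂ν := by
        rw [← Real.norm_eq_abs]
        refine norm_integral_le_of_norm_le
          (integrable_finsetSum _ fun i _ => (hint i).1.const_mul _) ?_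
        filter_upwards [ae_all_iff.2 hpos] with z hz
        refine (abs_ciSup_sub_ciSup_le _ _).trans (Finset.sum_le_sum fun i _ => ?_)
        rw [← sub_mul, abs_mul, abs_of_nonneg (hz i)]
        exact mul_le_mul_of_nonneg_right (abs_abs_sub_abs_le _ _) (hz i)
    _ = ∑ i, |x i - y i| := by
        rw [integral_finsetSum _ fun i _ => (hint i).1.const_mul _]
        refine Finset.sum_congr rfl fun i _ => ?_
        rw [integral_const_mul, (hint i).2, mul_one]

lemma continuous (hN : IsDNorm N) : Continuous N := by
  rw [continuous_iff_continuousAt]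
  intro x
  rw [ContinuousAt, tendsto_iff_dist_tendsto_zero]
  refine squeeze_zero (fun _ => dist_nonneg) (fun y => hN.abs_sub_le y x) ?_
  have : Continuous fun y : Fin d → ℝ => ∑ i, |y i - x i| := by fun_prop
  simpa using this.tendsto x

lemma smul (hN : IsDNorm N) {c : ℝ} (hc : 0 ≤ c) (x : Fin d → ℝ) : N (c • x) = c * N x := by
  obtain ⟨ν, _, -, -, hNx⟩ := hN
  rw [hNx, hNx, ← integral_const_mul]
  refine integral_congr_ae (.of_forall fun z => ?_)
  simp only [Pi.smul_apply, smul_eq_mul, abs_mul, abs_of_nonneg hc, mul_assoc]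
  rw [Real.mul_iSup_of_nonneg hc]

end IsDNorm

/-! ### Moments of centred indicators under uniform margins -/

section Copula

variable {d : ℕ} {P : Measure (Fin d → ℝ)}

lemma measureReal_le_of_uniform
    (hP : ∀ i, P.map (fun x => x i) = volume.restrict (Set.Icc (0 : ℝ) 1)) (i : Fin d) {a : ℝ}
    (h0 : 0 ≤ a) (h1 : a ≤ 1) : P.real {x | x i ≤ a} = a := by
  have h : P.real {x | x i ≤ a} = (P.map fun x => x i).real (Set.Iic a) := by
    rw [map_measureReal_apply (measurable_pi_apply i) measurableSet_Iic]
    rfl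
  rw [h, hP, measureReal_restrict_apply measurableSet_Iic, Set.inter_comm, ← Set.Ici_inter_Iic,
    Set.inter_assoc, Set.Iic_inter_Iic, Set.Ici_inter_Iic]
  simp [h0, h1]

/-- Almost surely all coordinates are `≤ 1`, so bounding the remaining ones by `1` costs nothing.
This expresses bivariate margins through the copula. -/
lemma measureReal_le_and_le_of_uniform
    (hP : ∀ i, P.map (fun x => x i) = volume.restrict (Set.Icc (0 : ℝ) 1)) {i j : Fin d}
    (hij : i ≠ j) {a b : ℝ} :
    P.real {x | x i ≤ a ∧ x j ≤ b}
      = P.real (Set.Iic (Function.update (Function.update 1 i a) j b)) := by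
  have hle : ∀ᵐ x ∂P, ∀ l, x l ≤ 1 := by
    refine ae_all_iff.2 fun l => ?_
    have : ∀ᵐ s ∂(P.map fun x => x l), s ≤ 1 := by
      rw [hP]
      exact (ae_restrict_mem measurableSet_Icc).mono fun s hs => hs.2
    exact ae_of_ae_map (measurable_pi_apply l).aemeasurable this
  refine measureReal_congr ?_
  filter_upwards [hle] with x hx
  refine propext ⟨fun h l => ?_, fun h => ⟨?_, ?_⟩⟩
  · by_cases hl : l = j
    · subst hl; simpa using h.2
    · by_cases hl' : l = i
      · subst hl'; simpa [Function.update_of_ne hl] using h.1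
      · simpa [Function.update_of_ne hl, Function.update_of_ne hl'] using hx l
  · have := h i
    simpa [Function.update_of_ne hij] using this
  · have := h j
    simpa using this

lemma integral_indicator_Iic (i : Fin d) (a : ℝ) :
    ∫ x, (Set.Iic a).indicator (1 : ℝ → ℝ) (x i) ∂P = P.real {x | x i ≤ a} :=
  integral_indicator_one (measurableSet_Iic.preimage (measurable_pi_apply i))

variable [IsProbabilityMeasure P]

lemma integrable_centeredBelow (i : Fin d) (a : ℝ) :
    Integrable (fun x => centeredBelow a (x i)) P :=
  (integrable_const a).sub
    (((integrable_const 1).indicator (measurableSet_Iic.preimage (measurable_pi_apply i))).congr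
      (.of_forall fun _ => rfl))

lemma integrable_centeredBelow_mul (i j : Fin d) {a b : ℝ} (h0 : 0 ≤ a) (h1 : a ≤ 1) :
    Integrable (fun x => centeredBelow a (x i) * centeredBelow b (x j)) P :=
  (integrable_centeredBelow j b).bdd_mul
    ((measurable_centeredBelow a).comp (measurable_pi_apply i)).aestronglyMeasurable
    (.of_forall fun _ => abs_centeredBelow_le h0 h1 _)

lemma integral_centeredBelow
    (hP : ∀ i, P.map (fun x => x i) = volume.restrict (Set.Icc (0 : ℝ) 1)) (i : Fin d) {a : ℝ}
    (h0 : 0 ≤ a) (h1 : a ≤ 1) : ∫ x, centeredBelow a (x i) ∂P = 0 := by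
  have hi : Integrable (fun x => (Set.Iic a).indicator (1 : ℝ → ℝ) (x i)) P :=
    ((integrable_const 1).indicator (measurableSet_Iic.preimage (measurable_pi_apply i))).congr
      (.of_forall fun _ => rfl)
  unfold centeredBelow
  rw [integral_sub (integrable_const a) hi, integral_indicator_Iic,
    measureReal_le_of_uniform hP i h0 h1]
  simp

lemma integral_centeredBelow_mul
    (hP : ∀ i, P.map (fun x => x i) = volume.restrict (Set.Icc (0 : ℝ) 1)) (i j : Fin d) {a b : ℝ}
    (h0 : 0 ≤ a) (h1 : a ≤ 1) (h0' : 0 ≤ b) (h1' : b ≤ 1) :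
    ∫ x, centeredBelow a (x i) * centeredBelow b (x j) ∂P
      = P.real {x | x i ≤ a ∧ x j ≤ b} - a * b := by
  have hms : MeasurableSet {x : Fin d → ℝ | x i ≤ a ∧ x j ≤ b} :=
    (measurableSet_Iic.preimage (measurable_pi_apply i)).inter
      (measurableSet_Iic.preimage (measurable_pi_apply j))
  have hind : Integrable ({x : Fin d → ℝ | x i ≤ a ∧ x j ≤ b}.indicator (1 : (Fin d → ℝ) → ℝ)) P :=
    (integrable_const 1).indicator hms
  -- The product is expanded so that the linear terms are themselves centred and integrate to `0`.
  have heq : ∀ x : Fin d → ℝ, centeredBelow a (x i) * centeredBelow b (x j)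
      = {x : Fin d → ℝ | x i ≤ a ∧ x j ≤ b}.indicator (1 : (Fin d → ℝ) → ℝ) x
        + b * centeredBelow a (x i) + a * centeredBelow b (x j) - a * b := fun x => by
    unfold centeredBelow
    by_cases h : x i ≤ a <;> by_cases h' : x j ≤ b <;> simp [h, h'] <;> ring
  simp only [heq]
  have i1 := (integrable_centeredBelow (P := P) i a).const_mul b
  have i2 := (integrable_centeredBelow (P := P) j b).const_mul a
  have i12 : Integrable (fun x => {x : Fin d → ℝ | x i ≤ a ∧ x j ≤ b}.indicator
      (1 : (Fin d → ℝ) → ℝ) x + b * centeredBelow a (x i)) P := hind.add i1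
  have i123 : Integrable (fun x => {x : Fin d → ℝ | x i ≤ a ∧ x j ≤ b}.indicator
      (1 : (Fin d → ℝ) → ℝ) x + b * centeredBelow a (x i) + a * centeredBelow b (x j)) P :=
    i12.add i2
  rw [integral_sub i123 (integrable_const _), integral_add i12 i2,
    integral_add hind i1, integral_const_mul, integral_const_mul,
    integral_centeredBelow hP i h0 h1, integral_centeredBelow hP j h0' h1',
    integral_indicator_one hms]
  simp

/-- The integral is the variance of the indicator of an interval of length `|a - b|`, namely `|a -
b| - |a - b|²`. -/
lemma integral_centeredBelow_sub_sq_le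
    (hP : ∀ i, P.map (fun x => x i) = volume.restrict (Set.Icc (0 : ℝ) 1)) (i : Fin d) {a b : ℝ}
    (h0 : 0 ≤ a) (h1 : a ≤ 1) (h0' : 0 ≤ b) (h1' : b ≤ 1) :
    ∫ x, (centeredBelow a (x i) - centeredBelow b (x i)) ^ 2 ∂P ≤ |a - b| := by
  have hmin : ∀ {a b : ℝ}, 0 ≤ a → a ≤ 1 → 0 ≤ b → b ≤ 1 →
      P.real {x | x i ≤ a ∧ x i ≤ b} = min a b := fun h0 h1 h0' h1' => by
    simp only [← le_min_iff]
    exact measureReal_le_of_uniform hP i (le_min h0 h0') ((min_le_left _ _).trans h1)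
  have heq : ∀ x : Fin d → ℝ, (centeredBelow a (x i) - centeredBelow b (x i)) ^ 2
      = centeredBelow a (x i) * centeredBelow a (x i)
        + centeredBelow b (x i) * centeredBelow b (x i)
        - 2 * (centeredBelow a (x i) * centeredBelow b (x i)) := fun x => by ring
  simp only [heq]
  have i1 : Integrable _ P := integrable_centeredBelow_mul i i (b := a) h0 h1
  have i2 : Integrable _ P := integrable_centeredBelow_mul i i (b := b) h0' h1'
  have i3 : Integrable _ P := integrable_centeredBelow_mul i i (b := b) h0 h1
  have i12 : Integrable (fun x => centeredBelow a (x i) * centeredBelow a (x i)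
      + centeredBelow b (x i) * centeredBelow b (x i)) P := i1.add i2
  rw [integral_sub i12 (i3.const_mul 2), integral_add i1 i2, integral_const_mul,
    integral_centeredBelow_mul hP i i h0 h1 h0 h1,
    integral_centeredBelow_mul hP i i h0' h1' h0' h1',
    integral_centeredBelow_mul hP i i h0 h1 h0' h1', hmin h0 h1 h0 h1, hmin h0' h1' h0' h1',
    hmin h0 h1 h0' h1', min_self, min_self]
  rcases le_total a b with h | h
  · rw [min_eq_left h, abs_of_nonpos (by linarith)]
    nlinarith [sq_nonneg (a - b)]
  · rw [min_eq_right h, abs_of_nonneg (by linarith)]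
    nlinarith [sq_nonneg (a - b)]

end Copula

/-! ### Asymptotics of the ranks and of the covariances -/

section Ranks

variable {d : ℕ} {k : ℕ → Fin d → ℕ} {κ : Fin d → Fin d → ℝ}

lemma eventually_rank_pos (hκ : ∀ i j, 0 < κ i j)
    (hkκ : ∀ i j, Tendsto (fun n => (k n i : ℝ) / (k n j : ℝ)) atTop (𝓝 (κ i j ^ 2)))
    (i : Fin d) : ∀ᶠ n in atTop, (0 : ℝ) < k n i := by
  filter_upwards [(hkκ i i).eventually_const_lt (pow_pos (hκ i i) 2)] with n hn
  -- If `k n i = 0` then `k n i / k n i = 0` by convention, contradicting a ratio close to `κ i i ^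
  -- 2 > 0`.
  rcases (Nat.cast_nonneg (k n i) : (0 : ℝ) ≤ k n i).eq_or_lt with h | h
  · rw [← h] at hn
    simp at hn
  · exact h

/-- Each `k_i` is comparable to `‖k‖`: `‖k‖ = k_i ‖k / k_i‖`, and the second factor has a positive
finite limit. -/
lemma tendsto_rank_atTop (hκ : ∀ i j, 0 < κ i j)
    (hkκ : ∀ i j, Tendsto (fun n => (k n i : ℝ) / (k n j : ℝ)) atTop (𝓝 (κ i j ^ 2)))
    (hk_top : Tendsto (fun n => ‖fun i => (k n i : ℝ)‖) atTop atTop) (i : Fin d) :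
    Tendsto (fun n => (k n i : ℝ)) atTop atTop := by
  have hlim : Tendsto (fun n => ‖fun j => (k n j : ℝ) / (k n i : ℝ)‖) atTop
      (𝓝 ‖fun j => κ j i ^ 2‖) := (tendsto_pi_nhds.2 fun j => hkκ j i).norm
  have hpos : 0 < ‖fun j => κ j i ^ 2‖ := norm_pos_iff.2 fun h =>
    (pow_pos (hκ i i) 2).ne' (congrFun h i)
  refine (hk_top.atTop_mul_pos (inv_pos.2 hpos) (hlim.inv₀ hpos.ne')).congr' ?_
  filter_upwards [eventually_rank_pos hκ hkκ i, hlim.eventually_const_lt hpos] with n hn hn'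
  have : (fun j => (k n j : ℝ)) = (k n i : ℝ) • fun j => (k n j : ℝ) / (k n i : ℝ) := by
    ext j
    simp only [Pi.smul_apply, smul_eq_mul]
    field_simp
  rw [this, norm_smul, Real.norm_of_nonneg hn.le, mul_assoc, mul_inv_cancel₀ hn'.ne', mul_one]

lemma tendsto_rank_div (hk_div : Tendsto (fun n => ‖fun i => (k n i : ℝ)‖ / (n : ℝ)) atTop (𝓝 0))
    (i : Fin d) : Tendsto (fun n => (k n i : ℝ) / (n : ℝ)) atTop (𝓝 0) := by
  refine squeeze_zero (fun n => by positivity) (fun n => ?_) hk_div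
  gcongr
  have := norm_le_pi_norm (fun i => (k n i : ℝ)) i
  rwa [Real.norm_of_nonneg (Nat.cast_nonneg _)] at this

lemma tendsto_sqrt_rank_div (hκ : ∀ i j, 0 < κ i j)
    (hkκ : ∀ i j, Tendsto (fun n => (k n i : ℝ) / (k n j : ℝ)) atTop (𝓝 (κ i j ^ 2)))
    (i j : Fin d) :
    Tendsto (fun n => √(k n i : ℝ) / √(k n j : ℝ)) atTop (𝓝 (κ i j)) := by
  have := (Real.continuous_sqrt.tendsto _).comp (hkκ i j)
  rw [Real.sqrt_sq (hκ i j).le] at this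
  exact this.congr fun n => by simp [Real.sqrt_div]

variable {C N : (Fin d → ℝ) → ℝ} {P : Measure (Fin d → ℝ)} [IsProbabilityMeasure P]

/-- The normalized covariances of the centred indicators at the levels `1 - k i / n` converge to
the entries of `intermediateCov N κ`. -/
lemma tendsto_covariance
    (hP : ∀ i, P.map (fun x => x i) = volume.restrict (Set.Icc (0 : ℝ) 1))
    (hPC : ∀ x, C x = P.real (Set.Iic x)) (hN : IsDNorm N) (hCN : HasDNormExpansion C N)
    (hκ : ∀ i j, 0 < κ i j)
    (hkκ : ∀ i j, Tendsto (fun n => (k n i : ℝ) / (k n j : ℝ)) atTop (𝓝 (κ i j ^ 2)))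
    (hk_div : Tendsto (fun n => ‖fun i => (k n i : ℝ)‖ / (n : ℝ)) atTop (𝓝 0)) (i j : Fin d) :
    Tendsto (fun n : ℕ => (n : ℝ) / (√(k n i : ℝ) * √(k n j : ℝ)) *
      ∫ x, centeredBelow (1 - k n i / n) (x i) * centeredBelow (1 - k n j / n) (x j) ∂P)
      atTop (𝓝 (intermediateCov N κ i j)) := by
  have hp := tendsto_rank_div hk_div
  have hp0 : ∀ n i, (0 : ℝ) ≤ (k n i : ℝ) / n := fun n i => by positivity
  rcases eq_or_ne i j with rfl | hij
  · have hlim : Tendsto (fun n : ℕ => 1 - (k n i : ℝ) / n) atTop (𝓝 (intermediateCov N κ i i)) := by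
      simpa [intermediateCov] using (hp i).const_sub 1
    refine hlim.congr' ?_
    filter_upwards [eventually_rank_pos hκ hkκ i, (hp i).eventually_le_const zero_lt_one,
      eventually_gt_atTop 0] with n hk h1 hn
    have hn' : (0 : ℝ) < n := by exact_mod_cast hn
    rw [integral_centeredBelow_mul hP i i (by linarith) (by linarith [hp0 n i]) (by linarith)
      (by linarith [hp0 n i]), Real.mul_self_sqrt hk.le]
    simp only [and_self]
    rw [measureReal_le_of_uniform hP i (by linarith) (by linarith [hp0 n i])]
    field_simp
    ring
  set e : Fin d → Fin d → ℝ := fun i => Pi.single i 1 with he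
  -- `u n` is the corner point whose only coordinates different from `1` are `1 - k_i/n` and `1 -
  -- k_j/n`; its copula value is the joint probability needed.
  set u : ℕ → Fin d → ℝ := fun n =>
    Function.update (Function.update 1 i (1 - k n i / n)) j (1 - k n j / n) with hu
  have h1u : ∀ n, 1 - u n = ((k n i : ℝ) / n) • e i + ((k n j : ℝ) / n) • e j := fun n => by
    ext l
    by_cases hl : l = j
    · subst hl; simp [hu, he, hij]
    · by_cases hl' : l = i
      · subst hl'; simp [hu, he, hij]
      · simp [hu, he, hl, hl']
  have hnorm : ∀ n, ‖1 - u n‖ ≤ (k n i : ℝ) / n + (k n j : ℝ) / n := fun n => by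
    rw [h1u]
    refine (norm_add_le _ _).trans (le_of_eq ?_)
    simp only [he, norm_smul, Pi.norm_single, norm_one, mul_one]
    rw [Real.norm_of_nonneg (hp0 n i), Real.norm_of_nonneg (hp0 n j)]
  have hu1 : Tendsto u atTop (𝓝[Set.Icc 0 1] 1) := by
    refine tendsto_nhdsWithin_iff.2 ⟨?_, ?_⟩
    · rw [tendsto_iff_norm_sub_tendsto_zero]
      refine squeeze_zero (fun _ => norm_nonneg _) (fun n => ?_)
        (by simpa using (hp i).add (hp j))
      rw [norm_sub_rev]
      exact hnorm n
    · filter_upwards [(hp i).eventually_le_const zero_lt_one,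
        (hp j).eventually_le_const zero_lt_one] with n h1 h2
      have hl : ∀ l, 0 ≤ u n l ∧ u n l ≤ 1 := fun l => by
        by_cases hl : l = j
        · subst hl
          simpa [hu, h2] using hp0 n l
        · by_cases hl' : l = i
          · subst hl'
            simpa [hu, hl, h1] using hp0 n l
          · simp [hu, hl, hl']
      exact ⟨fun l => (hl l).1, fun l => (hl l).2⟩
  have hA := tendsto_sqrt_rank_div hκ hkκ i j
  have hB := tendsto_sqrt_rank_div hκ hkκ j i
  set c : ℕ → ℝ := fun n => (n : ℝ) / (√(k n i : ℝ) * √(k n j : ℝ)) with hc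
  set r : ℕ → ℝ := fun n => C (u n) - (1 - N (1 - u n)) with hr
  have hev : ∀ᶠ n : ℕ in atTop, 0 < n ∧ (0 : ℝ) < k n i ∧ (0 : ℝ) < k n j ∧
      (k n i : ℝ) / n ≤ 1 ∧ (k n j : ℝ) / n ≤ 1 := by
    filter_upwards [eventually_rank_pos hκ hkκ i, eventually_rank_pos hκ hkκ j,
      (hp i).eventually_le_const zero_lt_one, (hp j).eventually_le_const zero_lt_one,
      eventually_gt_atTop 0] with n a1 a2 a3 a4 a5
    exact ⟨a5, a1, a2, a3, a4⟩
  have hci : ∀ᶠ n in atTop, c n * ((k n i : ℝ) / n) = √(k n i : ℝ) / √(k n j : ℝ) := by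
    filter_upwards [hev] with n ⟨h0, h1, h2, _, _⟩
    have := Real.sq_sqrt h1.le
    have h3 := Real.sqrt_pos.2 h1
    have h4 := Real.sqrt_pos.2 h2
    simp only [hc]
    field_simp
    exact this.symm
  have hcj : ∀ᶠ n in atTop, c n * ((k n j : ℝ) / n) = √(k n j : ℝ) / √(k n i : ℝ) := by
    filter_upwards [hev] with n ⟨h0, h1, h2, _, _⟩
    have := Real.sq_sqrt h2.le
    have h3 := Real.sqrt_pos.2 h1
    have h4 := Real.sqrt_pos.2 h2
    simp only [hc]
    field_simp
    exact this.symm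
  -- The remainder is `o(p + q)`, while `c (p + q)` converges to `κ i j + κ j i` and is therefore
  -- bounded.
  have hrem : Tendsto (fun n => c n * r n) atTop (𝓝 0) := by
    have hr1 : r =o[atTop] fun n => (k n i : ℝ) / n + (k n j : ℝ) / n := by
      refine (IsLittleO.comp_tendsto hCN hu1).trans_isBigO (IsBigO.of_bound 1 (.of_forall fun n => ?_))
      simp only [Function.comp_apply, norm_norm, one_mul]
      exact (hnorm n).trans (le_abs_self _)
    have hbd : (fun n => c n * ((k n i : ℝ) / n + (k n j : ℝ) / n)) =O[atTop] fun _ => (1 : ℝ) := by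
      refine ((hA.add hB).congr' ?_).isBigO_one ℝ
      filter_upwards [hci, hcj] with n h1 h2
      rw [mul_add, h1, h2]
    exact (isLittleO_one_iff ℝ).1 (((isBigO_refl c atTop).mul_isLittleO hr1).trans_isBigO hbd)
  have hNlim : Tendsto (fun n => N ((√(k n i : ℝ) / √(k n j : ℝ)) • e i
      + (√(k n j : ℝ) / √(k n i : ℝ)) • e j)) atTop (𝓝 (N (κ i j • e i + κ j i • e j))) :=
    (hN.continuous.tendsto _).comp ((hA.smul_const _).add (hB.smul_const _))
  have hprod : Tendsto (fun n => √((k n i : ℝ) / n) * √((k n j : ℝ) / n)) atTop (𝓝 0) := by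
    simpa using ((Real.continuous_sqrt.tendsto _).comp (hp i)).mul
      ((Real.continuous_sqrt.tendsto _).comp (hp j))
  have hlim := (((hA.add hB).sub hNlim).sub hprod).add hrem
  have hgoal : κ i j + κ j i - N (κ i j • e i + κ j i • e j) - 0 + 0 = intermediateCov N κ i j := by
    simp [intermediateCov, hij, he]
  rw [hgoal] at hlim
  refine hlim.congr' ?_
  filter_upwards [hev, hci, hcj] with n ⟨h0, h1, h2, h3, h4⟩ hcin hcjn
  have hn' : (0 : ℝ) < n := by exact_mod_cast h0
  rw [integral_centeredBelow_mul hP i j (by linarith) (by linarith [hp0 n i]) (by linarith)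
      (by linarith [hp0 n j]), measureReal_le_and_le_of_uniform hP hij, ← hPC]
  have hCu : C (u n) = 1 - N (1 - u n) + r n := by simp [hr]
  have hNu : N ((√(k n i : ℝ) / √(k n j : ℝ)) • e i + (√(k n j : ℝ) / √(k n i : ℝ)) • e j)
      = c n * N (1 - u n) := by
    rw [← hN.smul (by positivity), h1u, smul_add, smul_smul, smul_smul, hcin, hcjn]
  have hpq : √((k n i : ℝ) / n) * √((k n j : ℝ) / n) = c n * ((k n i : ℝ) / n * ((k n j : ℝ) / n)) := by
    have h5 := Real.sqrt_pos.2 h1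
    have h6 := Real.sqrt_pos.2 h2
    have h8 := Real.sq_sqrt h2.le
    rw [← mul_assoc, hcin, Real.sqrt_div h1.le, Real.sqrt_div h2.le, div_mul_div_comm,
      Real.mul_self_sqrt hn'.le, div_mul_div_comm, div_eq_div_iff hn'.ne' (by positivity)]
    linear_combination (√(k n i : ℝ) * n) * h8
  change _ = c n * (C (u n) - _)
  rw [hNu, hpq, hCu, ← hcin, ← hcjn]
  ring

end Ranks

/-! ### Reduction to counts and the central limit theorem -/

section Main

lemma normalizedIntermediateOS_apply_le_iff {Ω : Type*} {d : ℕ} {X : ℕ → Ω → Fin d → ℝ}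
    {k : ℕ → Fin d → ℕ} {n : ℕ} {i : Fin d} (hk0 : 0 < k n i)
    (hkn : k n i + 1 ≤ n) (ω : Ω) (y : ℝ) :
    normalizedIntermediateOS X k n ω i ≤ y ↔
      (∑ m : Fin n, centeredBelow (1 - k n i / n + y * √(k n i : ℝ) / n) (X m ω i))
        / √(k n i : ℝ) ≤ y := by
  have hn : (0 : ℝ) < n := by exact_mod_cast (by omega : 0 < n)
  have hs : 0 < √(k n i : ℝ) := Real.sqrt_pos.2 (by exact_mod_cast hk0)
  have e : (n : ℝ) * (1 - k n i / n + y * √(k n i : ℝ) / n) - (n - k n i) = y * √(k n i : ℝ) := by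
    field_simp
    ring
  have h := orderStat_sub_le_iff hkn (fun m : Fin n => X m ω i)
    (1 - k n i / n + y * √(k n i : ℝ) / n)
  rw [e] at h
  rw [div_le_iff₀ hs, ← h]
  simp only [normalizedIntermediateOS]
  rw [div_mul_eq_mul_div, div_le_iff₀ hs, ← le_div_iff₀' hn, sub_le_iff_le_add]
  have e2 : y * √(k n i : ℝ) / n + ((n : ℝ) - k n i) / n = 1 - k n i / n + y * √(k n i : ℝ) / n := by
    field_simp
    ring
  rw [e2]

variable {Ω : Type*} [MeasurableSpace Ω] {μ : Measure Ω} [IsProbabilityMeasure μ]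
  {d : ℕ} {X : ℕ → Ω → Fin d → ℝ} {P : Measure (Fin d → ℝ)} [IsProbabilityMeasure P]
  {k : ℕ → Fin d → ℕ}

/-- A Bahadur type representation: a normalized intermediate order statistic differs from the
normalized centred count of observations below a fixed level by a term vanishing in probability. -/
lemma tendsto_measureReal_normalizedIntermediateOS_sub
    (hXmeas : ∀ m, Measurable (X m)) (hXindep : iIndepFun X μ) (hlaw : ∀ m, μ.map (X m) = P)
    (hP : ∀ i, P.map (fun x => x i) = volume.restrict (Set.Icc (0 : ℝ) 1)) (i : Fin d)
    (hkn : ∀ᶠ n in atTop, k n i + 1 ≤ n)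
    (hk_top : Tendsto (fun n => (k n i : ℝ)) atTop atTop)
    (hk_div : Tendsto (fun n => (k n i : ℝ) / (n : ℝ)) atTop (𝓝 0)) :
    ∀ ε > 0, Tendsto (fun n => μ.real {ω | ε ≤ |normalizedIntermediateOS X k n ω i
      - (∑ m : Fin n, centeredBelow (1 - k n i / n) (X m ω i)) / √(k n i : ℝ)|}) atTop (𝓝 0) := by
  have hsqrt : Tendsto (fun n => √(k n i : ℝ)) atTop atTop := Real.tendsto_sqrt_atTop.comp hk_top
  have hpos : ∀ᶠ n in atTop, 0 < k n i :=
    (hk_top.eventually_gt_atTop 0).mono fun n hn => by exact_mod_cast hn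
  have hcm : ∀ a : ℝ, Measurable fun x : Fin d → ℝ => centeredBelow a (x i) := fun a =>
    (measurable_centeredBelow a).comp (measurable_pi_apply i)
  refine tendstoInMeasure_sub_of_le_iff (T := fun y n ω =>
    (∑ m : Fin n, centeredBelow (1 - k n i / n + y * √(k n i : ℝ) / n) (X m ω i))
      / √(k n i : ℝ)) ?_ ?_ ?_
  · intro δ hδ
    -- Chebyshev with variance at most `k` bounds the probability by `1/M²`; `M = δ⁻¹ + 1` works
    -- because `δ M² = δ⁻¹ + 2 + δ ≥ 1`.
    refine ⟨δ⁻¹ + 1, ?_⟩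
    filter_upwards [hpos, hkn] with n hk0 hkn
    have hn : (0 : ℝ) < n := by exact_mod_cast (by omega : 0 < n)
    have hk : (0 : ℝ) < k n i := by exact_mod_cast hk0
    have hs : 0 < √(k n i : ℝ) := Real.sqrt_pos.2 hk
    have hδ' : 0 < δ⁻¹ := inv_pos.2 hδ
    have hp : (k n i : ℝ) / n ≤ 1 := by
      rw [div_le_one hn]; exact_mod_cast (by omega : k n i ≤ n)
    have hp0 : 0 ≤ (k n i : ℝ) / n := by positivity
    have h := measureReal_le_abs_sum_le hXmeas hXindep hlaw (hcm (1 - k n i / n))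
      (fun x => abs_centeredBelow_le (by linarith) (by linarith) (x i))
      (integral_centeredBelow hP i (by linarith) (by linarith)) n
      (c := (δ⁻¹ + 1) * √(k n i : ℝ)) (by positivity)
    have hvar : n * ∫ x, centeredBelow (1 - k n i / n) (x i) ^ 2 ∂P ≤ k n i := by
      simp only [sq]
      rw [integral_centeredBelow_mul hP i i (by linarith) (by linarith) (by linarith) (by linarith)]
      simp only [and_self]
      rw [measureReal_le_of_uniform hP i (by linarith) (by linarith)]
      have : (k n i : ℝ) = n * (k n i / n) := by field_simp
      conv_rhs => rw [this]
      gcongr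
      nlinarith [sq_nonneg ((k n i : ℝ) / n)]
    simp only [abs_div, abs_of_pos hs, le_div_iff₀ hs]
    refine h.trans ?_
    rw [div_le_iff₀ (by positivity), mul_pow, Real.sq_sqrt hk.le]
    refine hvar.trans ?_
    rw [← mul_assoc]
    refine le_mul_of_one_le_left hk.le ?_
    have : δ * (δ⁻¹ + 1) ^ 2 = δ⁻¹ + 2 + δ := by field_simp; ring
    linarith
  · intro y
    filter_upwards [hpos, hkn] with n hk0 hkn ω
    exact normalizedIntermediateOS_apply_le_iff hk0 hkn ω y
  · intro y ε hε
    have hlev : Tendsto (fun n : ℕ => 1 - (k n i : ℝ) / n + y * √(k n i : ℝ) / n) atTop (𝓝 1) := by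
      have h1 : Tendsto (fun n : ℕ => (k n i : ℝ) / n * (√(k n i : ℝ))⁻¹) atTop (𝓝 0) := by
        simpa using hk_div.mul hsqrt.inv_tendsto_atTop
      have h2 : Tendsto (fun n : ℕ => y * √(k n i : ℝ) / n) atTop (𝓝 0) := by
        have := h1.const_mul y
        rw [mul_zero] at this
        refine this.congr' ?_
        filter_upwards [hpos] with n hn
        have hk : (0 : ℝ) < k n i := by exact_mod_cast hn
        have hs : 0 < √(k n i : ℝ) := Real.sqrt_pos.2 hk
        have := Real.mul_self_sqrt hk.le
        field_simp
        rw [sq, this]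
      simpa using (hk_div.const_sub 1).add h2
    -- Convergence of the level to `1` does not keep it below `1`; that needs `y√k ≤ k`, true once
    -- `√k ≥ y`.
    have hle : ∀ᶠ n : ℕ in atTop, 1 - (k n i : ℝ) / n + y * √(k n i : ℝ) / n ≤ 1 := by
      have hsy : ∀ᶠ n in atTop, y ≤ √(k n i : ℝ) := hsqrt.eventually_ge_atTop y
      filter_upwards [hsy, hpos] with n h1 h2
      have : y * √(k n i : ℝ) ≤ k n i := by
        calc y * √(k n i : ℝ) ≤ √(k n i : ℝ) * √(k n i : ℝ) := by gcongr
          _ = k n i := Real.mul_self_sqrt (Nat.cast_nonneg _)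
      have : y * √(k n i : ℝ) / n ≤ k n i / n := by gcongr
      linarith
    have hbound : Tendsto (fun n => |y| / ε ^ 2 * (√(k n i : ℝ))⁻¹) atTop (𝓝 0) := by
      simpa using hsqrt.inv_tendsto_atTop.const_mul (|y| / ε ^ 2)
    refine squeeze_zero' (.of_forall fun _ => measureReal_nonneg) ?_ hbound
    filter_upwards [hpos, hkn, hlev.eventually_const_le zero_lt_one, hle] with n hk0 hkn ha0 ha1
    have hn : (0 : ℝ) < n := by exact_mod_cast (by omega : 0 < n)
    have hk : (0 : ℝ) < k n i := by exact_mod_cast hk0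
    have hs : 0 < √(k n i : ℝ) := Real.sqrt_pos.2 hk
    have hp : (k n i : ℝ) / n ≤ 1 := by
      rw [div_le_one hn]; exact_mod_cast (by omega : k n i ≤ n)
    have hp0 : 0 ≤ (k n i : ℝ) / n := by positivity
    have hb0 : 0 ≤ 1 - (k n i : ℝ) / n := by linarith
    have hb1 : 1 - (k n i : ℝ) / n ≤ 1 := by linarith
    have h := measureReal_le_abs_sum_le hXmeas hXindep hlaw
      (f := fun x => centeredBelow (1 - (k n i : ℝ) / n + y * √(k n i : ℝ) / n) (x i)
        - centeredBelow (1 - k n i / n) (x i)) ((hcm _).sub (hcm _))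
      (B := 1 + 1) (fun x => (abs_sub _ _).trans (add_le_add
        (abs_centeredBelow_le ha0 ha1 (x i)) (abs_centeredBelow_le hb0 hb1 (x i))))
      (by rw [integral_sub (integrable_centeredBelow i _) (integrable_centeredBelow i _),
        integral_centeredBelow hP i ha0 ha1, integral_centeredBelow hP i hb0 hb1, sub_zero]) n
      (c := ε * √(k n i : ℝ)) (by positivity)
    simp only [← sub_div, ← Finset.sum_sub_distrib, abs_div, abs_of_pos hs, le_div_iff₀ hs]
    refine h.trans ?_
    have hvar := integral_centeredBelow_sub_sq_le hP i ha0 ha1 hb0 hb1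
    rw [add_sub_cancel_left, abs_div, abs_mul, abs_of_pos hs, abs_of_pos hn] at hvar
    calc _ ≤ n * (|y| * √(k n i : ℝ) / n) / (ε * √(k n i : ℝ)) ^ 2 := by gcongr
      _ = _ := by field_simp

lemma measurable_normalizedIntermediateOS (hXmeas : ∀ m, Measurable (X m)) (n : ℕ) :
    Measurable (normalizedIntermediateOS X k n) := by
  refine (WithLp.measurable_toLp 2 _).comp (measurable_pi_lambda _ fun i => ?_)
  refine Measurable.const_mul (Measurable.sub_const ?_ _) _
  exact (measurable_orderStat (n - k n i)).comp
    (measurable_pi_lambda _ fun m => (measurable_pi_apply i).comp (hXmeas m))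

/-- The vector of centred indicators at the levels `1 - k i / n`, normalized by `√(k i)`. -/
noncomputable def normalizedBelow (k : ℕ → Fin d → ℕ) (n : ℕ) (x : Fin d → ℝ) :
    EuclideanSpace ℝ (Fin d) :=
  WithLp.toLp 2 fun i => centeredBelow (1 - k n i / n) (x i) / √(k n i : ℝ)

lemma measurable_normalizedBelow (n : ℕ) : Measurable (normalizedBelow k n) :=
  (WithLp.measurable_toLp 2 _).comp (measurable_pi_lambda _ fun i =>
    ((measurable_centeredBelow _).comp (measurable_pi_apply i)).div_const _)

lemma inner_normalizedBelow (n : ℕ) (x : Fin d → ℝ) (t : EuclideanSpace ℝ (Fin d)) :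
    inner ℝ (normalizedBelow k n x) t
      = ∑ i, t i * (centeredBelow (1 - k n i / n) (x i) / √(k n i : ℝ)) := by
  simp [normalizedBelow, PiLp.inner_apply]

variable {C N : (Fin d → ℝ) → ℝ} {κ : Fin d → Fin d → ℝ}

lemma tendsto_second_moment
    (hP : ∀ i, P.map (fun x => x i) = volume.restrict (Set.Icc (0 : ℝ) 1))
    (hPC : ∀ x, C x = P.real (Set.Iic x)) (hN : IsDNorm N) (hCN : HasDNormExpansion C N)
    (hκ : ∀ i j, 0 < κ i j)
    (hkκ : ∀ i j, Tendsto (fun n => (k n i : ℝ) / (k n j : ℝ)) atTop (𝓝 (κ i j ^ 2)))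
    (hk_div : Tendsto (fun n => ‖fun i => (k n i : ℝ)‖ / (n : ℝ)) atTop (𝓝 0))
    (t : EuclideanSpace ℝ (Fin d)) :
    Tendsto (fun n : ℕ => n * ∫ x, (inner ℝ (normalizedBelow k n x) t) ^ 2 ∂P) atTop
      (𝓝 (t.ofLp ⬝ᵥ (intermediateCov N κ).mulVec t.ofLp)) := by
  have hlim := tendsto_finsetSum Finset.univ fun i _ => tendsto_finsetSum Finset.univ fun j _ =>
    (tendsto_covariance hP hPC hN hCN hκ hkκ hk_div i j).const_mul (t i * t j)
  have hval : ∑ i, ∑ j, t i * t j * intermediateCov N κ i j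
      = t.ofLp ⬝ᵥ (intermediateCov N κ).mulVec t.ofLp := by
    simp only [dotProduct, Matrix.mulVec, Finset.mul_sum]
    exact Finset.sum_congr rfl fun i _ => Finset.sum_congr rfl fun j _ => by ring
  rw [hval] at hlim
  refine hlim.congr' ?_
  have hle : ∀ᶠ n : ℕ in atTop, ∀ i, (k n i : ℝ) / n ≤ 1 := Filter.eventually_all.2 fun i =>
    (tendsto_rank_div hk_div i).eventually_le_const zero_lt_one
  filter_upwards [hle] with n hn
  have hp0 : ∀ i, (0 : ℝ) ≤ (k n i : ℝ) / n := fun i => by positivity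
  have hint : ∀ i j, Integrable (fun x : Fin d → ℝ => t i * t j / (√(k n i : ℝ) * √(k n j : ℝ)) *
      (centeredBelow (1 - k n i / n) (x i) * centeredBelow (1 - k n j / n) (x j))) P := fun i j =>
    (integrable_centeredBelow_mul i j (by linarith [hn i]) (by linarith [hp0 i])).const_mul _
  have hsq : ∀ x : Fin d → ℝ, (inner ℝ (normalizedBelow k n x) t) ^ 2
      = ∑ i, ∑ j, t i * t j / (√(k n i : ℝ) * √(k n j : ℝ)) *
        (centeredBelow (1 - k n i / n) (x i) * centeredBelow (1 - k n j / n) (x j)) := fun x => by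
    rw [inner_normalizedBelow, sq, Finset.sum_mul_sum]
    exact Finset.sum_congr rfl fun i _ => Finset.sum_congr rfl fun j _ => by ring
  simp only [hsq]
  rw [integral_finsetSum _ fun i _ => integrable_finsetSum _ fun j _ => hint i j, Finset.mul_sum]
  refine Finset.sum_congr rfl fun i _ => ?_
  rw [integral_finsetSum _ fun j _ => hint i j, Finset.mul_sum]
  refine Finset.sum_congr rfl fun j _ => ?_
  rw [integral_const_mul]
  ring

/-- The quadratic form at `t` is the limit of the nonnegative numbers `n ∫ ⟨·, t⟩²`. The
characteristic function of the limiting Gaussian also relies on this. -/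
lemma posSemidef_intermediateCov
    (hP : ∀ i, P.map (fun x => x i) = volume.restrict (Set.Icc (0 : ℝ) 1))
    (hPC : ∀ x, C x = P.real (Set.Iic x)) (hN : IsDNorm N) (hCN : HasDNormExpansion C N)
    (hκ : ∀ i j, 0 < κ i j)
    (hkκ : ∀ i j, Tendsto (fun n => (k n i : ℝ) / (k n j : ℝ)) atTop (𝓝 (κ i j ^ 2)))
    (hk_div : Tendsto (fun n => ‖fun i => (k n i : ℝ)‖ / (n : ℝ)) atTop (𝓝 0)) :
    (intermediateCov N κ).PosSemidef := by
  refine Matrix.posSemidef_iff_dotProduct_mulVec.2 ⟨?_, fun t => ?_⟩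
  · refine Matrix.IsHermitian.ext fun i j => ?_
    by_cases hij : i = j
    · simp [hij]
    · simp only [intermediateCov, Matrix.of_apply, hij, Ne.symm hij, if_false, star_trivial]
      rw [add_comm (κ j i), add_comm (κ j i • _)]
  · have h := tendsto_second_moment hP hPC hN hCN hκ hkκ hk_div (WithLp.toLp 2 t)
    rw [star_trivial]
    exact ge_of_tendsto' h fun n => mul_nonneg (Nat.cast_nonneg _)
      (integral_nonneg fun x => sq_nonneg _)

/-- The multivariate central limit theorem for the counts of observations below the levels
`1 - k i / n`. -/
lemma tendstoInDistribution_sum_normalizedBelow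
    (hXmeas : ∀ m, Measurable (X m)) (hXindep : iIndepFun X μ) (hlaw : ∀ m, μ.map (X m) = P)
    (hP : ∀ i, P.map (fun x => x i) = volume.restrict (Set.Icc (0 : ℝ) 1))
    (hPC : ∀ x, C x = P.real (Set.Iic x)) (hN : IsDNorm N) (hCN : HasDNormExpansion C N)
    (hκ : ∀ i j, 0 < κ i j)
    (hkκ : ∀ i j, Tendsto (fun n => (k n i : ℝ) / (k n j : ℝ)) atTop (𝓝 (κ i j ^ 2)))
    (hk_top : Tendsto (fun n => ‖fun i => (k n i : ℝ)‖) atTop atTop)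
    (hk_div : Tendsto (fun n => ‖fun i => (k n i : ℝ)‖ / (n : ℝ)) atTop (𝓝 0)) :
    TendstoInDistribution (fun n ω => ∑ m : Fin n, normalizedBelow k n (X m ω)) atTop
      (id : EuclideanSpace ℝ (Fin d) → EuclideanSpace ℝ (Fin d)) (fun _ => μ)
      (multivariateGaussian 0 (intermediateCov N κ)) where
  forall_aemeasurable n := (Finset.measurable_sum
    (f := fun (m : Fin n) ω => normalizedBelow k n (X m ω)) Finset.univ fun m _ =>
      (measurable_normalizedBelow n).comp (hXmeas m)).aemeasurable
  aemeasurable_limit := aemeasurable_id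
  tendsto := by
    refine ProbabilityMeasure.tendsto_iff_tendsto_charFun.2 fun t => ?_
    simp only [ProbabilityMeasure.coe_mk, Measure.map_id]
    rw [charFun_multivariateGaussian (posSemidef_intermediateCov hP hPC hN hCN hκ hkκ hk_div)]
    have hchar : ∀ n, charFun (μ.map fun ω => ∑ m : Fin n, normalizedBelow k n (X m ω)) t
        = (∫ x, Complex.exp ((inner ℝ (normalizedBelow k n x) t : ℝ) * Complex.I) ∂P) ^ n := by
      intro n
      have hm := measurable_normalizedBelow (k := k) n
      have hind : iIndepFun (fun (m : Fin n) ω => normalizedBelow k n (X m ω)) μ :=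
        (hXindep.precomp Fin.val_injective).comp (fun _ => normalizedBelow k n) fun _ => hm
      rw [iIndepFun.charFun_map_fun_sum_eq_prod
        (X := fun (m : Fin n) ω => normalizedBelow k n (X m ω))
        (fun m => (hm.comp (hXmeas m)).aemeasurable) hind]
      simp only [Finset.prod_apply]
      have hone : ∀ m : Fin n, charFun (μ.map fun ω => normalizedBelow k n (X m ω)) t
          = ∫ x, Complex.exp ((inner ℝ (normalizedBelow k n x) t : ℝ) * Complex.I) ∂P := fun m => by
        rw [charFun_apply, ← hlaw m,
          integral_map (φ := fun ω => normalizedBelow k n (X m ω))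
            (hm.comp (hXmeas m)).aemeasurable (by fun_prop),
          integral_map (hXmeas m).aemeasurable (Measurable.aestronglyMeasurable (by fun_prop))]
      simp [hone]
    simp only [hchar]
    -- Since each centred indicator is at most `1` in absolute value, this bounds the summands
    -- uniformly; it vanishes because every `k_i → ∞`.
    have hb : Tendsto (fun n => ∑ i, |t i| * (√(k n i : ℝ))⁻¹) atTop (𝓝 0) := by
      simpa using tendsto_finsetSum Finset.univ fun i _ => (Real.tendsto_sqrt_atTop.comp
        (tendsto_rank_atTop hκ hkκ hk_top i)).inv_tendsto_atTop.const_mul |t i|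
    have hle : ∀ᶠ n : ℕ in atTop, ∀ i, (k n i : ℝ) / n ≤ 1 := Filter.eventually_all.2 fun i =>
      (tendsto_rank_div hk_div i).eventually_le_const zero_lt_one
    have hp0 : ∀ n i, (0 : ℝ) ≤ (k n i : ℝ) / n := fun n i => by positivity
    have h := tendsto_integral_exp_pow (P := P) (Y := fun n x => inner ℝ (normalizedBelow k n x) t)
      (fun n => (measurable_normalizedBelow n).inner_const) hb
      (by
        filter_upwards [hle] with n hn x
        rw [inner_normalizedBelow]
        refine (Finset.abs_sum_le_sum_abs _ _).trans (Finset.sum_le_sum fun i _ => ?_)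
        rw [abs_mul, abs_div, abs_of_nonneg (Real.sqrt_nonneg _), div_eq_mul_inv]
        gcongr
        refine mul_le_of_le_one_left (by positivity)
          (abs_centeredBelow_le (by linarith [hn i]) (by linarith [hp0 n i]) _))
      (by
        filter_upwards [hle] with n hn
        simp only [inner_normalizedBelow]
        rw [integral_finsetSum _ fun i _ =>
          ((integrable_centeredBelow i _).div_const _).const_mul _]
        refine Finset.sum_eq_zero fun i _ => ?_
        rw [integral_const_mul, integral_div,
          integral_centeredBelow hP i (by linarith [hn i]) (by linarith [hp0 n i])]
        simp)
      (tendsto_second_moment hP hPC hN hCN hκ hkκ hk_div t)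
    simpa [neg_div] using h

end Main

/-! ### From coordinates to the vector: the theorem -/

lemma EuclideanSpace.norm_le_sum_abs {ι : Type*} [Fintype ι] (v : EuclideanSpace ℝ ι) :
    ‖v‖ ≤ ∑ i, |v i| := by
  rw [EuclideanSpace.norm_eq]
  refine Real.sqrt_le_iff.2 ⟨Finset.sum_nonneg fun _ _ => abs_nonneg _, ?_⟩
  simp only [Real.norm_eq_abs]
  exact Finset.sum_sq_le_sq_sum_of_nonneg fun _ _ => abs_nonneg _

theorem theorem2p1 {Ω : Type*} [MeasurableSpace Ω] (μ : Measure Ω) [IsProbabilityMeasure μ]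
    (d : ℕ) (C N : (Fin d → ℝ) → ℝ) (hC : IsCopula C) (hN : IsDNorm N)
    (hCN : HasDNormExpansion C N)
    (X : ℕ → Ω → Fin d → ℝ) (hXmeas : ∀ m, Measurable (X m)) (hXindep : iIndepFun X μ)
    (hXC : ∀ m x, μ.real {ω | X m ω ≤ x} = C x)
    (k : ℕ → Fin d → ℕ) (hk : ∀ n, 2 ≤ n → ∀ i, 1 ≤ k n i ∧ k n i ≤ n - 1)
    (κ : Fin d → Fin d → ℝ) (hκ : ∀ i j, 0 < κ i j)
    (hkκ : ∀ i j, Tendsto (fun n => (k n i : ℝ) / (k n j : ℝ)) atTop (𝓝 (κ i j ^ 2)))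
    (hk_top : Tendsto (fun n => ‖fun i => (k n i : ℝ)‖) atTop atTop)
    (hk_div : Tendsto (fun n => ‖fun i => (k n i : ℝ)‖ / (n : ℝ)) atTop (𝓝 0)) :
    (intermediateCov N κ).PosSemidef ∧
      TendstoInDistribution (normalizedIntermediateOS X k) atTop
        (id : EuclideanSpace ℝ (Fin d) → EuclideanSpace ℝ (Fin d)) (fun _ => μ)
        (multivariateGaussian 0 (intermediateCov N κ)) := by
  obtain ⟨P, hPprob, hP, hPC⟩ := hC
  -- Every copy has law `P`, since both distribution functions equal `C`.
  have hlaw : ∀ m, μ.map (X m) = P := fun m => by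
    have := Measure.isProbabilityMeasure_map (μ := μ) (hXmeas m).aemeasurable
    refine Measure.ext_of_Iic_pi fun x => ?_
    rw [← measureReal_eq_measureReal_iff, ← hPC,
      map_measureReal_apply (hXmeas m) measurableSet_Iic, ← hXC m x]
    rfl
  refine ⟨posSemidef_intermediateCov hP hPC hN hCN hκ hkκ hk_div, ?_⟩
  have hclt := tendstoInDistribution_sum_normalizedBelow hXmeas hXindep hlaw hP hPC hN hCN hκ hkκ
    hk_top hk_div
  -- Slutsky: a difference vanishing in probability does not affect the limit law, and this may be
  -- checked coordinatewise.
  refine tendstoInDistribution_of_tendstoInMeasure_sub _ _ hclt ?_ fun n =>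
    (measurable_normalizedIntermediateOS hXmeas n).aemeasurable
  rw [tendstoInMeasure_iff_measureReal_norm]
  intro ε hε
  have hcoord := fun i => tendsto_measureReal_normalizedIntermediateOS_sub
    hXmeas hXindep hlaw hP i
    (by filter_upwards [eventually_ge_atTop 2] with n hn
        have := hk n hn i
        omega)
    (tendsto_rank_atTop hκ hkκ hk_top i) (tendsto_rank_div hk_div i)
  -- Dividing by `d + 1` keeps the sum of `d` such terms strictly below `ε` and covers `d = 0`.
  have hε' : 0 < ε / (d + 1) := by positivity
  refine squeeze_zero (fun _ => measureReal_nonneg) (fun n => ?_)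
    (by simpa using tendsto_finsetSum Finset.univ fun i _ => hcoord i _ hε')
  refine (measureReal_mono fun ω hω => ?_).trans (measureReal_iUnion_fintype_le _)
  simp only [Set.mem_iUnion, Set.mem_ofPred_eq] at hω ⊢
  by_contra! hlt
  have hnorm := EuclideanSpace.norm_le_sum_abs
    (normalizedIntermediateOS X k n ω - ∑ m : Fin n, normalizedBelow k n (X m ω))
  have hsum : ∑ i, |(normalizedIntermediateOS X k n ω
      - ∑ m : Fin n, normalizedBelow k n (X m ω)) i| ≤ ∑ _i : Fin d, ε / (d + 1) := by
    refine Finset.sum_le_sum fun i _ => ?_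
    have := (hlt i).le
    rw [Finset.sum_div] at this
    simpa [normalizedBelow] using this
  have hlast : ∑ _i : Fin d, ε / (d + 1) < ε := by
    simp only [Finset.sum_const, Finset.card_univ, Fintype.card_fin, nsmul_eq_mul]
    rw [mul_div_assoc', div_lt_iff₀ (by positivity)]
    nlinarith
  simp only [Pi.sub_apply, Pi.zero_apply, sub_zero] at hω
  linarith
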